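/- An oriented graph is a directed graph without loops in which any two distinct vertices are joined by at most one directed edge. Let $I_m$ denote the graph on $m$ vertices without edges and $L_n$ the transitive tournament on $n$ vertices, and let $r(I_m, L_n)$ be the least natural number $k$ such that every oriented graph on $k$ vertices contains $I_m$ or $L_n$ as an induced subgraph. For all integers $m, n \geq 2$, the number $r(I_m, L_n)$ exists and $$ r(I_m, L_n) \leq 2^{19n} \cdot \frac{m^{n-1}}{(\log_2 m)^{n-2}}. $$ -/

import Mathlib

/-- An oriented graph on the vertex set `V`: a directed graph without loops and without double
edges, i.e. every edge has exactly one orientation. Loops are excluded by `asymm` with `a = b`. -/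
structure OrientedGraph (V : Type*) where
  /-- `Adj a b` means that there is an edge directed from `a` to `b`. -/
  Adj : V → V → Prop
  asymm : ∀ a b, Adj a b → ¬ Adj b a

namespace OrientedGraph

/-- The oriented graph on `m` vertices without edges, `I_m`. -/
def independent (m : ℕ) : OrientedGraph (Fin m) where
  Adj _ _ := False
  asymm _ _ h := h.elim

/-- The transitive tournament on `n` vertices, `L_n`: vertices `0, …, n - 1`, with an edge from
`i` to `j` exactly when `i < j`. -/
def transTournament (n : ℕ) : OrientedGraph (Fin n) where
  Adj i j := i < j
  asymm _ _ h := lt_asymm h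

/-- `D.Contains S`: the oriented graph `S` is isomorphic to an induced subgraph of `D`. -/
def Contains {V W : Type*} (D : OrientedGraph V) (S : OrientedGraph W) : Prop :=
  Nonempty (S.Adj ↪r D.Adj)

end OrientedGraph

/-- The numbers `k` such that no oriented graph on `k` vertices is `(I_m, L_n)`-free. -/
def orientedRamseySet (m n : ℕ) : Set ℕ :=
  {k | ∀ D : OrientedGraph (Fin k),
    D.Contains (OrientedGraph.independent m) ∨ D.Contains (OrientedGraph.transTournament n)}

/-- The Ramsey number `r(I_m, L_n)`: the least element of `orientedRamseySet m n`. -/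
noncomputable def orientedRamsey (m n : ℕ) : ℕ :=
  sInf (orientedRamseySet m n)

/-!
Suppose all out-degrees in `s` are at most `a` and all common out-neighbourhoods of adjacent
vertices have at most `b` elements. A random subset of `s` of density about `1 / √(a b)` has average
degree about `√(a / b)` and few transitive triangles, which can be deleted. What remains has
no transitive triangle, so each neighbourhood is the union of two independent sets, the
out-neighbours and the in-neighbours. Shearer's argument then applies: in a uniformly random
independent set `W`, each vertex `v` lies in `W` or has many neighbours in `W` on average: given `W`
away from `v` and its neighbours, the independent subsets of the available part of the neighbourhood
are so numerous that, by Gibbs' inequality, a typical one is large. This gives an independent set of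
order `#s log (a / b) / a`.

If there is no `L_(n + 2)`, then the out-neighbourhoods contain no `L_(n + 1)` and the common
out-neighbourhoods of adjacent vertices no `L_n`, so induction on `n` supplies `a` and `b`, and the
absence of `I_m` bounds `#s`.
-/

open Finset

section SetFamily

variable {V : Type*} {K : Finset V} {F : Finset (Finset V)}

-- Gibbs' inequality for the uniform distribution on `F` against the distribution that puts each
-- element of `K` into a random set independently with odds `exp (-c) : 1`.
theorem card_mul_log_card_le (hF : F ⊆ K.powerset) (c : ℝ) :
    #F * Real.log #F ≤
      c * ∑ I ∈ F, (#I : ℝ) + #F * (#K * Real.log (1 + Real.exp (-c))) := by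
  set x := Real.exp (-c)
  have hx : 0 < x := Real.exp_pos _
  have hpartition : ∑ I ∈ F, x ^ #I ≤ (1 + x) ^ #K := calc
    ∑ I ∈ F, x ^ #I ≤ ∑ I ∈ K.powerset, x ^ #I :=
      sum_le_sum_of_subset_of_nonneg hF fun _ _ _ => by positivity
    _ = ∑ I ∈ K.powerset, x ^ #I * 1 ^ (#K - #I) := by simp only [one_pow, mul_one]
    _ = (1 + x) ^ #K := by rw [sum_pow_mul_eq_add_pow, add_comm]
  have hpoint : ∀ I ∈ F, Real.log #F - c * #I - #K * Real.log (1 + x) ≤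
      #F * x ^ #I / (1 + x) ^ #K - 1 := by
    intro I hI
    have hF0 : (0 : ℝ) < #F := by exact_mod_cast card_pos.2 ⟨I, hI⟩
    refine le_of_eq_of_le ?_ (Real.log_le_sub_one_of_pos (by positivity))
    rw [Real.log_div (by positivity) (by positivity), Real.log_mul hF0.ne' (by positivity),
      Real.log_pow, Real.log_pow, Real.log_exp]
    ring
  have hsum := sum_le_sum hpoint
  simp only [sum_sub_distrib, sum_const, nsmul_eq_mul, ← mul_sum, ← sum_div, mul_one] at hsum
  have hratio : #F * (∑ I ∈ F, x ^ #I) / (1 + x) ^ #K ≤ #F := by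
    rw [div_le_iff₀ (by positivity)]
    gcongr
  linarith

theorem card_mul_card_le_sum_card (hF : F ⊆ K.powerset) (hcard : 2 ^ #K ≤ #F ^ 2) :
    (#K : ℝ) * #F ≤ 16 * ∑ I ∈ F, (#I : ℝ) := by
  have hF0 : (0 : ℝ) < #F := by
    have : 0 < #F ^ 2 := hcard.trans_lt' (by positivity)
    exact_mod_cast Nat.pos_of_ne_zero (by rintro h; simp [h] at this)
  have hlogF : #K * Real.log 2 ≤ 2 * Real.log #F := by
    have := Real.log_le_log (by positivity) (show (2 : ℝ) ^ #K ≤ #F ^ 2 by exact_mod_cast hcard)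
    simpa only [Real.log_pow, Nat.cast_ofNat] using this
  have hgibbs := card_mul_log_card_le hF (3 * Real.log 2)
  have hexp : Real.exp (-(3 * Real.log 2)) = 1 / 8 := by
    rw [Real.exp_neg, mul_comm, Real.exp_mul, Real.exp_log (by norm_num)]
    norm_num
  have hlog : Real.log (1 + 1 / 8) ≤ 5 / 16 * Real.log 2 := by
    have := Real.log_le_sub_one_of_pos (show (0 : ℝ) < 1 + 1 / 8 by norm_num)
    linarith [Real.log_two_gt_d9]
  rw [hexp] at hgibbs
  have hlogF' := mul_le_mul_of_nonneg_left hlogF hF0.le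
  have hlog' := mul_le_mul_of_nonneg_left hlog (show (0 : ℝ) ≤ #F * #K by positivity)
  have : 3 * Real.log 2 * (#K * #F) ≤ 3 * Real.log 2 * (16 * ∑ I ∈ F, (#I : ℝ)) := by linarith
  exact le_of_mul_le_mul_left this (by positivity)

end SetFamily

theorem logb_two_le_mul {x : ℝ} (hx : 0 < x) : Real.logb 2 x ≤ 7 / 8 * x := by
  have htangent := Real.log_le_sub_one_of_pos (half_pos hx)
  rw [Real.log_div hx.ne' (by norm_num)] at htangent
  have hlog_lower := Real.log_two_gt_d9
  have hlog_upper := Real.log_two_lt_d9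
  rw [Real.logb, div_le_iff₀ (by linarith)]
  nlinarith

theorem one_le_logb_two {x : ℝ} (hx : 2 ≤ x) : 1 ≤ Real.logb 2 x := by
  rwa [Real.le_logb_iff_rpow_le one_lt_two (by linarith), Real.rpow_one]

theorem le_mul_div_logb_two {c x : ℝ} (hc : 0 ≤ c) (hx : 2 ≤ x) :
    c ≤ c * x / Real.logb 2 x := by
  have hlog : Real.logb 2 x ≤ 7 / 8 * x := logb_two_le_mul (by linarith)
  rw [le_div_iff₀ (zero_lt_one.trans_le (one_le_logb_two hx))]
  gcongr
  linarith

theorem logb_two_div_eight_le_logb_mul_div_logb {c x : ℝ} (hc : 1 ≤ c) (hx : 2 ≤ x) :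
    Real.logb 2 x / 8 ≤ Real.logb 2 (c * x / Real.logb 2 x) := by
  have hlog : 0 < Real.logb 2 x := zero_lt_one.trans_le (one_le_logb_two hx)
  have hloglog : Real.logb 2 (Real.logb 2 x) ≤ 7 / 8 * Real.logb 2 x := logb_two_le_mul hlog
  have hc_nonneg : 0 ≤ Real.logb 2 c := Real.logb_nonneg one_lt_two hc
  rw [Real.logb_div (by positivity) hlog.ne', Real.logb_mul (by positivity) (by positivity)]
  linarith

theorem logb_two_le_mul_sqrt {x : ℝ} (hx : 0 < x) : Real.logb 2 x ≤ 7 / 4 * √x := by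
  have hsqrt := logb_two_le_mul (Real.sqrt_pos.2 hx)
  have hdouble : Real.logb 2 x = 2 * Real.logb 2 √x := by
    conv_lhs => rw [← Real.sq_sqrt hx.le, Real.logb_pow, Nat.cast_ofNat]
  linarith

-- Either `d ≤ 4 ^ k`, and the bound comes from `T`, or `Z ≤ √d`, and it comes from `d`.
theorem logb_mul_one_add_le {d Z T : ℝ} {k : ℕ} (hd : 1 ≤ d) (hZ_one : 1 ≤ Z) (hZ : Z ≤ 2 ^ k)
    (hT : k * Z ≤ 16 * T) : Real.logb 2 d / 64 * (1 + Z) ≤ d + T := by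
  have hT_nonneg : 0 ≤ k * Z := by positivity
  rcases le_or_gt d (4 ^ k) with hdk | hdk
  · have hlog : Real.logb 2 d ≤ 2 * k := by
      have := Real.logb_le_logb_of_le one_lt_two (by linarith) hdk
      rwa [Real.logb_pow, show (4 : ℝ) = 2 ^ 2 by norm_num, Real.logb_pow,
        Real.logb_self_eq_one one_lt_two, mul_one, mul_comm] at this
    calc Real.logb 2 d / 64 * (1 + Z) ≤ 2 * k / 64 * (Z + Z) := by gcongr
      _ ≤ d + T := by linarith
  · have hZ_sqrt : Z ≤ √d := by
      refine hZ.trans (Real.le_sqrt_of_sq_le ?_)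
      rw [← pow_mul, mul_comm, pow_mul]
      norm_num [hdk.le]
    have hsqrt : √d * √d = d := Real.mul_self_sqrt (by linarith)
    calc Real.logb 2 d / 64 * (1 + Z) ≤ (7 / 4 * √d) / 64 * (√d + √d) := by
          gcongr
          · exact logb_two_le_mul_sqrt (by linarith)
          · exact hZ_one.trans hZ_sqrt
      _ ≤ d + T := by linarith

section IndepSubsets

variable {V : Type*} {G : SimpleGraph V} {S A B : Finset V} {v : V} {d : ℝ}

open scoped Classical in
/-- The independent sets of `G` contained in the finite set `S`. Their uniform distribution is the
one used to find a large independent set. -/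
noncomputable def indepSubsets (G : SimpleGraph V) (S : Finset V) : Finset (Finset V) :=
  {W ∈ S.powerset | G.IsIndepSet W}

theorem mem_indepSubsets {W : Finset V} :
    W ∈ indepSubsets G S ↔ W ⊆ S ∧ ∀ x ∈ W, ∀ y ∈ W, ¬ G.Adj x y := by
  classical
  refine mem_filter.trans (and_congr mem_powerset ?_)
  exact ⟨fun h x hx y hy hxy => h hx hy hxy.ne hxy, fun h x hx y hy _ => h x hx y hy⟩

theorem indepSubsets_nonempty : (indepSubsets G S).Nonempty :=
  ⟨∅, mem_indepSubsets.2 (by simp)⟩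

theorem indepSubsets_subset_powerset : indepSubsets G S ⊆ S.powerset :=
  fun _ hW => mem_powerset.2 (mem_indepSubsets.1 hW).1

theorem two_pow_card_le_sq_card_indepSubsets (hA : G.IsIndepSet (A : Set V))
    (hB : G.IsIndepSet (B : Set V)) [DecidableEq V] (hAB : S ⊆ A ∪ B) :
    2 ^ #S ≤ #(indepSubsets G S) ^ 2 := by
  have hsub : ∀ C : Finset V, G.IsIndepSet (C : Set V) →
      2 ^ #(S ∩ C) ≤ #(indepSubsets G S) := by
    intro C hC
    rw [← card_powerset]
    refine card_le_card fun J hJ => mem_indepSubsets.2 ?_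
    obtain ⟨hJS, hJC⟩ := subset_inter_iff.1 (mem_powerset.1 hJ)
    exact ⟨hJS, fun x hx y hy h => hC (hJC hx) (hJC hy) h.ne h⟩
  have hcover : #S ≤ #(S ∩ A) + #(S ∩ B) := by
    calc #S = #(S ∩ A ∪ S ∩ B) := by rw [← inter_union_distrib_left, inter_eq_left.2 hAB]
      _ ≤ #(S ∩ A) + #(S ∩ B) := card_union_le _ _
  calc 2 ^ #S ≤ 2 ^ #(S ∩ A) * 2 ^ #(S ∩ B) := by
        rw [← pow_add]
        exact Nat.pow_le_pow_right two_pos hcover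
    _ ≤ #(indepSubsets G S) ^ 2 := by
        rw [sq]
        exact Nat.mul_le_mul (hsub A hA) (hsub B hB)

theorem logb_mul_one_add_card_indepSubsets_le [DecidableEq V] (hd : 1 ≤ d)
    (hA : G.IsIndepSet (A : Set V)) (hB : G.IsIndepSet (B : Set V)) (hAB : S ⊆ A ∪ B) :
    Real.logb 2 d / 64 * (1 + #(indepSubsets G S)) ≤ d + ∑ J ∈ indepSubsets G S, (#J : ℝ) := by
  have hpow : #(indepSubsets G S) ≤ 2 ^ #S :=
    card_powerset S ▸ card_le_card indepSubsets_subset_powerset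
  exact logb_mul_one_add_le hd (by exact_mod_cast indepSubsets_nonempty.card_pos)
    (by exact_mod_cast hpow) (card_mul_card_le_sum_card indepSubsets_subset_powerset
      (two_pow_card_le_sq_card_indepSubsets hA hB hAB))

theorem sum_card_filter_adj_le [DecidableRel G.Adj] {W : Finset V} (hWS : W ⊆ S)
    (hdeg : ∀ v ∈ S, (#{u ∈ S | G.Adj v u} : ℝ) ≤ d) :
    ∑ v ∈ S, (#{u ∈ W | G.Adj v u} : ℝ) ≤ d * #W := by
  have hcount : ∑ v ∈ S, #{u ∈ W | G.Adj v u} = ∑ w ∈ W, #{u ∈ S | G.Adj w u} := by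
    simpa only [bipartiteAbove, bipartiteBelow, G.adj_comm] using
      sum_card_bipartiteAbove_eq_sum_card_bipartiteBelow (s := S) (t := W) G.Adj
  rw [← Nat.cast_sum, hcount, Nat.cast_sum, mul_comm, ← nsmul_eq_mul]
  exact sum_le_card_nsmul _ _ _ fun w hw => hdeg w (hWS hw)

variable [DecidableEq V] [DecidableRel G.Adj] {M : Type*} [AddCommMonoid M]

theorem sum_indepSubsets_filter_mem (hv : v ∈ S) (f : Finset V → M) :
    ∑ W ∈ indepSubsets G S with v ∈ W, f W =
      ∑ R ∈ indepSubsets G {u ∈ S | u ≠ v ∧ ¬ G.Adj v u}, f (insert v R) := by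
  refine sum_bij' (fun W _ => W.erase v) (fun R _ => insert v R) ?_ ?_ ?_ ?_ ?_
  · grind [mem_indepSubsets]
  · grind [mem_indepSubsets, G.adj_comm, G.irrefl]
  · grind
  · grind [mem_indepSubsets]
  · intro W hW
    rw [insert_erase (mem_filter.1 hW).2]

theorem sum_indepSubsets_filter_notMem (f : Finset V → M) :
    ∑ W ∈ indepSubsets G S with v ∉ W, f W =
      ∑ R ∈ indepSubsets G {u ∈ S | u ≠ v ∧ ¬ G.Adj v u},
        ∑ J ∈ indepSubsets G {u ∈ S | G.Adj v u ∧ ∀ x ∈ R, ¬ G.Adj x u}, f (R ∪ J) := by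
  rw [sum_sigma']
  refine sum_bij' (fun W _ => ⟨{u ∈ W | ¬ G.Adj v u}, {u ∈ W | G.Adj v u}⟩)
    (fun p _ => p.1 ∪ p.2) ?_ ?_ ?_ ?_ ?_
  · grind [mem_indepSubsets]
  · grind [mem_indepSubsets, G.adj_comm, G.irrefl]
  · grind
  · rintro ⟨R, J⟩ h
    simp only [mem_sigma, mem_indepSubsets] at h
    congr 1 <;> grind
  · intro W _
    congr 1
    grind

-- An independent set is determined by its part `R` away from the closed neighbourhood of `v`,
-- together with either `v` itself or an independent set of neighbours of `v` not adjacent to `R`.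
theorem sum_indepSubsets (hv : v ∈ S) (f : Finset V → M) :
    ∑ W ∈ indepSubsets G S, f W =
      ∑ R ∈ indepSubsets G {u ∈ S | u ≠ v ∧ ¬ G.Adj v u},
        (f (insert v R) +
          ∑ J ∈ indepSubsets G {u ∈ S | G.Adj v u ∧ ∀ x ∈ R, ¬ G.Adj x u}, f (R ∪ J)) := by
  rw [← sum_filter_add_sum_filter_not _ (v ∈ ·), sum_indepSubsets_filter_mem hv,
    sum_indepSubsets_filter_notMem, sum_add_distrib]

theorem logb_mul_card_indepSubsets_le_sum (hv : v ∈ S) (hd : 1 ≤ d)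
    (hA : G.IsIndepSet (A : Set V)) (hB : G.IsIndepSet (B : Set V))
    (hAB : {u ∈ S | G.Adj v u} ⊆ A ∪ B) :
    Real.logb 2 d / 64 * #(indepSubsets G S) ≤
      ∑ W ∈ indepSubsets G S, ((if v ∈ W then d else 0) + (#{u ∈ W | G.Adj v u} : ℝ)) := by
  rw [card_eq_sum_ones, Nat.cast_sum, sum_indepSubsets hv, sum_indepSubsets hv, mul_sum]
  refine sum_le_sum fun R _ => ?_
  set K := {u ∈ S | G.Adj v u ∧ ∀ x ∈ R, ¬ G.Adj x u}
  have hK : K ⊆ A ∪ B := fun u hu => hAB (by grind)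
  calc Real.logb 2 d / 64 * (((1 : ℕ) : ℝ) + ∑ _J ∈ indepSubsets G K, ((1 : ℕ) : ℝ))
      = Real.logb 2 d / 64 * (1 + #(indepSubsets G K)) := by simp
    _ ≤ d + ∑ J ∈ indepSubsets G K, (#J : ℝ) :=
      logb_mul_one_add_card_indepSubsets_le hd hA hB hK
    _ ≤ _ := by
      gcongr with J hJ
      · simp
      · have hJK := (mem_indepSubsets.1 hJ).1
        have hsub : J ⊆ {u ∈ R ∪ J | G.Adj v u} := by grind
        have hcard : (#J : ℝ) ≤ #{u ∈ R ∪ J | G.Adj v u} := by exact_mod_cast card_le_card hsub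
        split_ifs <;> linarith

-- The average over all independent `W ⊆ S` of `d * #W` plus the number of edges between `W` and
-- `S` is at least the sum over `v ∈ S` of the conditional expectations bounded above, while the
-- degree condition bounds this quantity by `2 * d * #W` for each `W`.
theorem exists_isIndepSet_of_neighborhoods_subset_union (hd : 1 ≤ d)
    (hdeg : ∀ v ∈ S, (#{u ∈ S | G.Adj v u} : ℝ) ≤ d)
    (hnbhd : ∀ v ∈ S, ∃ A B : Finset V, G.IsIndepSet (A : Set V) ∧ G.IsIndepSet (B : Set V) ∧
      {u ∈ S | G.Adj v u} ⊆ A ∪ B) :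
    ∃ W ⊆ S, G.IsIndepSet (W : Set V) ∧ #S * Real.logb 2 d / (128 * d) ≤ (#W : ℝ) := by
  have hvertex : ∀ v ∈ S, Real.logb 2 d / 64 * #(indepSubsets G S) ≤
      ∑ W ∈ indepSubsets G S, ((if v ∈ W then d else 0) + (#{u ∈ W | G.Adj v u} : ℝ)) := by
    intro v hv
    obtain ⟨A, B, hA, hB, hAB⟩ := hnbhd v hv
    exact logb_mul_card_indepSubsets_le_sum hv hd hA hB hAB
  have hset : ∀ W ∈ indepSubsets G S,
      ∑ v ∈ S, ((if v ∈ W then d else 0) + (#{u ∈ W | G.Adj v u} : ℝ)) ≤ 2 * d * #W := by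
    intro W hW
    have hWS := (mem_indepSubsets.1 hW).1
    have hvertices : ∑ v ∈ S, (if v ∈ W then d else 0) = d * #W := by
      rw [sum_ite_mem, inter_eq_right.2 hWS, sum_const, nsmul_eq_mul, mul_comm]
    rw [sum_add_distrib, hvertices]
    linarith [sum_card_filter_adj_le hWS hdeg]
  have htotal : ∑ _W ∈ indepSubsets G S, #S * (Real.logb 2 d / 64) ≤
      ∑ W ∈ indepSubsets G S, 2 * d * (#W : ℝ) := by
    calc ∑ _W ∈ indepSubsets G S, #S * (Real.logb 2 d / 64)
        = ∑ _v ∈ S, Real.logb 2 d / 64 * #(indepSubsets G S) := by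
          simp only [sum_const, nsmul_eq_mul]; ring
      _ ≤ _ := sum_le_sum hvertex
      _ = _ := sum_comm
      _ ≤ _ := sum_le_sum hset
  obtain ⟨W, hW, hle⟩ := exists_le_of_sum_le indepSubsets_nonempty htotal
  refine ⟨W, (mem_indepSubsets.1 hW).1,
    fun x hx y hy _ => (mem_indepSubsets.1 hW).2 x hx y hy, ?_⟩
  rw [div_le_iff₀ (by linarith)]
  linarith

end IndepSubsets

theorem card_lt_of_indepSetFree {V : Type*} {G : SimpleGraph V} {m : ℕ} {t : Finset V}
    (hG : G.IndepSetFree m) (ht : G.IsIndepSet (t : Set V)) : #t < m := by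
  by_contra! hmt
  obtain ⟨u, hut, hu⟩ := exists_subset_card_eq hmt
  exact hG u ⟨ht.mono (coe_subset.2 hut), hu⟩

section BernoulliSubset

variable {V : Type*} [DecidableEq V] {s : Finset V} {p : ℝ}

/-- The expectation of a function of the random subset of `s` that contains each element of `s`
independently with probability `p`, as a linear functional. -/
noncomputable def bernoulliExpect (s : Finset V) (p : ℝ) : (Finset V → ℝ) →ₗ[ℝ] ℝ :=
  ∑ W ∈ s.powerset, (p ^ #W * (1 - p) ^ #(s \ W)) • LinearMap.proj W

theorem bernoulliExpect_apply (f : Finset V → ℝ) :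
    bernoulliExpect s p f = ∑ W ∈ s.powerset, p ^ #W * (1 - p) ^ #(s \ W) * f W := by
  simp [bernoulliExpect]

-- Expand the product over `v ∈ s` of `p + 0` for `v ∈ t` and of `p + (1 - p)` for `v ∉ t`.
theorem bernoulliExpect_subset {t : Finset V} (hts : t ⊆ s) :
    bernoulliExpect s p (fun W => if t ⊆ W then 1 else 0) = p ^ #t := by
  have hprod : ∏ v ∈ s, (p + if v ∈ t then 0 else 1 - p) = p ^ #t := by
    rw [← prod_sdiff hts, prod_eq_one, one_mul, prod_congr rfl (g := fun _ => p), prod_const]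
    · intro v hv; simp [hv]
    · intro v hv; simp [(mem_sdiff.1 hv).2]
  rw [bernoulliExpect_apply, ← hprod, prod_add]
  refine sum_congr rfl fun W _ => ?_
  rw [prod_const, mul_assoc]
  congr 1
  split_ifs with htW
  · rw [mul_one, prod_congr rfl (g := fun _ => 1 - p), prod_const]
    exact fun v hv => if_neg fun hvt => (mem_sdiff.1 hv).2 (htW hvt)
  · obtain ⟨v, hvt, hvW⟩ := not_subset.1 htW
    rw [mul_zero, prod_eq_zero (mem_sdiff.2 ⟨hts hvt, hvW⟩)]
    simp [hvt]

theorem bernoulliExpect_eq_sum_pow_card {ι : Type*} {F : Finset ι} {f : ι → Finset V}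
    (hf : ∀ i ∈ F, f i ⊆ s) {g : Finset V → ℝ} (hg : ∀ W ⊆ s, g W = #{i ∈ F | f i ⊆ W}) :
    bernoulliExpect s p g = ∑ i ∈ F, p ^ #(f i) := by
  calc bernoulliExpect s p g
      = bernoulliExpect s p (∑ i ∈ F, fun W => if f i ⊆ W then 1 else 0) := by
        simp only [bernoulliExpect_apply]
        refine sum_congr rfl fun W hW => ?_
        rw [hg W (mem_powerset.1 hW), Finset.sum_apply, sum_boole]
    _ = ∑ i ∈ F, p ^ #(f i) := by
        rw [map_sum]
        exact sum_congr rfl fun i hi => bernoulliExpect_subset (hf i hi)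

theorem exists_bernoulliExpect_le (hp0 : 0 ≤ p) (hp1 : p ≤ 1) (f : Finset V → ℝ) :
    ∃ W ⊆ s, bernoulliExpect s p f ≤ f W := by
  obtain ⟨W, hW, hmax⟩ := exists_max_image s.powerset f ⟨∅, empty_mem_powerset s⟩
  have hone : ∑ U ∈ s.powerset, p ^ #U * (1 - p) ^ #(s \ U) = 1 := by
    simpa [bernoulliExpect_apply] using bernoulliExpect_subset (p := p) (empty_subset s)
  refine ⟨W, mem_powerset.1 hW, ?_⟩
  calc bernoulliExpect s p f
      ≤ ∑ U ∈ s.powerset, p ^ #U * (1 - p) ^ #(s \ U) * f W := by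
        rw [bernoulliExpect_apply]
        gcongr with U hU
        exact hmax U hU
    _ = f W := by rw [← sum_mul, hone, one_mul]

end BernoulliSubset

namespace OrientedGraph

variable {V : Type*} (D : OrientedGraph V)

instance : Std.Asymm D.Adj :=
  ⟨D.asymm⟩

variable {D} in
theorem ne_of_adj {u v : V} (h : D.Adj u v) : u ≠ v :=
  ne_of_irrefl h

/-- The undirected graph obtained from an oriented graph by forgetting the orientations. Its
independent sets are the vertex sets inducing some `I_m`. -/
def underlying : SimpleGraph V where
  Adj u v := D.Adj u v ∨ D.Adj v u
  symm := ⟨fun _ _ h => h.symm⟩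
  loopless := ⟨fun v h => h.elim (irrefl v) (irrefl v)⟩

instance [DecidableRel D.Adj] : DecidableRel D.underlying.Adj :=
  fun u v => inferInstanceAs (Decidable (D.Adj u v ∨ D.Adj v u))

section Sparsification

variable [DecidableRel D.Adj] (s : Finset V)

/-- The edges of `D` inside `s`, as ordered pairs. -/
def edgesIn : Finset (V × V) :=
  {e ∈ s ×ˢ s | D.Adj e.1 e.2}

/-- The transitive triangles of `D` inside `s`. Each is listed once, as its source, its middle
vertex and its sink. -/
def transTrianglesIn : Finset (V × V × V) :=
  {t ∈ s ×ˢ s ×ˢ s | D.Adj t.1 t.2.1 ∧ D.Adj t.1 t.2.2 ∧ D.Adj t.2.1 t.2.2}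

variable {D s}

theorem mem_edgesIn {u v : V} : (u, v) ∈ D.edgesIn s ↔ u ∈ s ∧ v ∈ s ∧ D.Adj u v := by
  simp [edgesIn, and_assoc]

theorem mem_transTrianglesIn {u v w : V} :
    (u, v, w) ∈ D.transTrianglesIn s ↔
      u ∈ s ∧ v ∈ s ∧ w ∈ s ∧ D.Adj u v ∧ D.Adj u w ∧ D.Adj v w := by
  simp [transTrianglesIn, and_assoc]

theorem sum_card_outNeighbors : ∑ v ∈ s, #{w ∈ s | D.Adj v w} = #(D.edgesIn s) := by
  simp only [edgesIn, card_filter, sum_product]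

theorem sum_card_inNeighbors : ∑ v ∈ s, #{u ∈ s | D.Adj u v} = #(D.edgesIn s) := by
  simp only [edgesIn, card_filter, sum_product_right]

theorem sum_card_underlying_neighbors :
    ∑ v ∈ s, #{w ∈ s | D.underlying.Adj v w} = 2 * #(D.edgesIn s) := by
  classical
  have hsplit : ∀ v ∈ s, #{w ∈ s | D.underlying.Adj v w} =
      #{w ∈ s | D.Adj v w} + #{w ∈ s | D.Adj w v} := by
    intro v _
    rw [← card_union_of_disjoint (disjoint_filter.2 fun w _ => D.asymm v w), ← filter_or]
    rfl
  rw [sum_congr rfl hsplit, sum_add_distrib, sum_card_outNeighbors, sum_card_inNeighbors, two_mul]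

theorem card_edgesIn_le {a : ℝ} (hout : ∀ v ∈ s, (#{w ∈ s | D.Adj v w} : ℝ) ≤ a) :
    (#(D.edgesIn s) : ℝ) ≤ #s * a := by
  rw [← sum_card_outNeighbors, Nat.cast_sum, ← nsmul_eq_mul]
  exact sum_le_card_nsmul _ _ _ hout

theorem card_transTrianglesIn_le {b : ℝ}
    (hco : ∀ u ∈ s, ∀ v ∈ s, D.Adj u v → (#{w ∈ s | D.Adj u w ∧ D.Adj v w} : ℝ) ≤ b) :
    (#(D.transTrianglesIn s) : ℝ) ≤ #(D.edgesIn s) * b := by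
  classical
  have hcount : #(D.transTrianglesIn s) =
      ∑ e ∈ D.edgesIn s, #{w ∈ s | D.Adj e.1 w ∧ D.Adj e.2 w} := by
    simp only [transTrianglesIn, edgesIn, card_filter, sum_product, sum_filter]
    refine sum_congr rfl fun u _ => sum_congr rfl fun v _ => ?_
    split_ifs with huv <;> simp [huv]
  rw [hcount, Nat.cast_sum, ← nsmul_eq_mul]
  refine sum_le_card_nsmul _ _ _ fun ⟨u, v⟩ he => ?_
  obtain ⟨hu, hv, huv⟩ := mem_edgesIn.1 he
  exact hco u hu v hv huv

theorem bernoulliExpect_card_edgesIn [DecidableEq V] (p : ℝ) :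
    bernoulliExpect s p (fun W => #(D.edgesIn W)) = p ^ 2 * #(D.edgesIn s) := by
  rw [bernoulliExpect_eq_sum_pow_card (F := D.edgesIn s) (f := fun e => {e.1, e.2}),
    sum_congr rfl fun e he => by rw [card_pair (ne_of_adj (mem_edgesIn.1 he).2.2)],
    sum_const, nsmul_eq_mul, mul_comm]
  · rintro ⟨u, v⟩ he
    grind [mem_edgesIn]
  · intro W hW
    congr 2
    ext ⟨u, v⟩
    grind [mem_edgesIn]

theorem bernoulliExpect_card_transTrianglesIn [DecidableEq V] (p : ℝ) :
    bernoulliExpect s p (fun W => #(D.transTrianglesIn W)) = p ^ 3 * #(D.transTrianglesIn s) := by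
  have hcard : ∀ t ∈ D.transTrianglesIn s, #({t.1, t.2.1, t.2.2} : Finset V) = 3 := by
    rintro ⟨u, v, w⟩ ht
    obtain ⟨-, -, -, huv, huw, hvw⟩ := mem_transTrianglesIn.1 ht
    exact card_eq_three.2 ⟨u, v, w, ne_of_adj huv, ne_of_adj huw, ne_of_adj hvw, rfl⟩
  rw [bernoulliExpect_eq_sum_pow_card (F := D.transTrianglesIn s)
    (f := fun t => {t.1, t.2.1, t.2.2}), sum_congr rfl fun t ht => by rw [hcard t ht],
    sum_const, nsmul_eq_mul, mul_comm]
  · rintro ⟨u, v, w⟩ ht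
    grind [mem_transTrianglesIn]
  · intro W hW
    congr 2
    ext ⟨u, v, w⟩
    grind [mem_transTrianglesIn]

theorem exists_subset_le_card_sub {p : ℝ} (hp0 : 0 ≤ p) (hp1 : p ≤ 1) (x y : ℝ) :
    ∃ W ⊆ s, p * #s - x * (p ^ 2 * #(D.edgesIn s)) - y * (p ^ 3 * #(D.transTrianglesIn s)) ≤
      #W - x * #(D.edgesIn W) - y * #(D.transTrianglesIn W) := by
  classical
  have hvertices : bernoulliExpect s p (fun W => #W) = p * #s := by
    rw [bernoulliExpect_eq_sum_pow_card (F := s) (f := singleton)]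
    · simp [mul_comm]
    · simp
    · intro W hW
      simp only [singleton_subset_iff, filter_mem_eq_inter, inter_eq_right.2 hW]
  have hle := exists_bernoulliExpect_le (s := s) hp0 hp1 ((fun W => (#W : ℝ)) -
    x • (fun W => (#(D.edgesIn W) : ℝ)) - y • fun W => (#(D.transTrianglesIn W) : ℝ))
  simpa only [map_sub, map_smul, hvertices, bernoulliExpect_card_edgesIn,
    bernoulliExpect_card_transTrianglesIn, Pi.sub_apply, Pi.smul_apply, smul_eq_mul] using hle

theorem card_filter_lt_degree_le {c : ℝ} (hc : 0 < c) (hedges : (#(D.edgesIn s) : ℝ) ≤ c * #s) :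
    4 * (#{v ∈ s | 8 * c < (#{w ∈ s | D.underlying.Adj v w} : ℝ)} : ℝ) ≤ #s := by
  set U := {v ∈ s | 8 * c < (#{w ∈ s | D.underlying.Adj v w} : ℝ)}
  have hmarkov : #U * (8 * c) ≤ 2 * #(D.edgesIn s) := calc
    #U * (8 * c) ≤ ∑ v ∈ U, (#{w ∈ s | D.underlying.Adj v w} : ℝ) := by
      rw [← nsmul_eq_mul]
      exact card_nsmul_le_sum U _ _ fun v hv => (mem_filter.1 hv).2.le
    _ ≤ ∑ v ∈ s, (#{w ∈ s | D.underlying.Adj v w} : ℝ) :=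
      sum_le_sum_of_subset_of_nonneg (filter_subset _ _) fun _ _ _ => Nat.cast_nonneg _
    _ = 2 * #(D.edgesIn s) := by exact_mod_cast sum_card_underlying_neighbors
  have : 2 * c * (4 * (#U : ℝ)) ≤ 2 * c * #s := by linarith
  exact le_of_mul_le_mul_left this (by positivity)

-- Delete the vertices of degree more than `8 * c` and the sources of the transitive triangles.
theorem exists_subset_degree_le_transTrianglesIn_eq_empty {c : ℝ} (hc : 0 < c)
    (hedges : (#(D.edgesIn s) : ℝ) ≤ c * #s)
    (htriangles : 4 * (#(D.transTrianglesIn s) : ℝ) ≤ #s) :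
    ∃ X ⊆ s, (#s : ℝ) / 2 ≤ #X ∧
      (∀ v ∈ X, (#{w ∈ X | D.underlying.Adj v w} : ℝ) ≤ 8 * c) ∧ D.transTrianglesIn X = ∅ := by
  classical
  set sources := (D.transTrianglesIn s).image Prod.fst
  set large := {v ∈ s | 8 * c < (#{w ∈ s | D.underlying.Adj v w} : ℝ)}
  have hX : s \ (sources ∪ large) ⊆ s := sdiff_subset
  refine ⟨s \ (sources ∪ large), hX, ?_, fun v hv => ?_, ?_⟩
  · have hlarge : 4 * (#large : ℝ) ≤ #s := card_filter_lt_degree_le hc hedges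
    have hsources : (#sources : ℝ) ≤ #(D.transTrianglesIn s) := by exact_mod_cast card_image_le
    have hdelete : (#s : ℝ) ≤ #(s \ (sources ∪ large)) + (#sources + #large) := by
      exact_mod_cast card_le_card_sdiff_add_card.trans
        (Nat.add_le_add_left (card_union_le _ _) _)
    linarith
  · have hv_small : (#{w ∈ s | D.underlying.Adj v w} : ℝ) ≤ 8 * c := by grind
    exact hv_small.trans' (by exact_mod_cast card_le_card (filter_subset_filter _ hX))
  · refine eq_empty_of_forall_notMem fun ⟨u, v, w⟩ ht => ?_
    have hsource : u ∈ sources := mem_image_of_mem Prod.fst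
      (show (u, v, w) ∈ D.transTrianglesIn s by grind [mem_transTrianglesIn])
    grind [mem_transTrianglesIn]

theorem exists_sparse_subset {a b p : ℝ} (ha : 0 < a) (hb : 0 ≤ b)
    (hout : ∀ v ∈ s, (#{w ∈ s | D.Adj v w} : ℝ) ≤ a)
    (hco : ∀ u ∈ s, ∀ v ∈ s, D.Adj u v → (#{w ∈ s | D.Adj u w ∧ D.Adj v w} : ℝ) ≤ b)
    (hp0 : 0 < p) (hp1 : p ≤ 1) (hpab : p ^ 2 * (a * b) ≤ 1 / 16) :
    ∃ X ⊆ s, p * #s / 4 ≤ #X ∧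
      (∀ v ∈ X, (#{w ∈ X | D.underlying.Adj v w} : ℝ) ≤ 32 * (p * a)) ∧
      D.transTrianglesIn X = ∅ := by
  obtain ⟨W, hWs, hW⟩ :=
    exists_subset_le_card_sub (D := D) (s := s) hp0.le hp1 (1 / (4 * (p * a))) 4
  have hedges : 1 / (4 * (p * a)) * (p ^ 2 * #(D.edgesIn s)) ≤ p * #s / 4 := calc
    _ ≤ 1 / (4 * (p * a)) * (p ^ 2 * (#s * a)) := by gcongr; exact card_edgesIn_le hout
    _ = p * #s / 4 := by field_simp
  have htriangles : 4 * (p ^ 3 * #(D.transTrianglesIn s)) ≤ p * #s / 4 := calc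
    _ ≤ 4 * (p ^ 3 * (#s * a * b)) := by
      gcongr
      exact (card_transTrianglesIn_le hco).trans (by gcongr; exact card_edgesIn_le hout)
    _ = 4 * p * #s * (p ^ 2 * (a * b)) := by ring
    _ ≤ 4 * p * #s * (1 / 16) := by gcongr
    _ = p * #s / 4 := by ring
  have hs_nonneg : 0 ≤ p * #s := by positivity
  have hedges_nonneg : 0 ≤ 1 / (4 * (p * a)) * #(D.edgesIn W) := by positivity
  have hedgesW : (#(D.edgesIn W) : ℝ) ≤ 4 * (p * a) * #W := by
    rw [← inv_mul_le_iff₀ (by positivity), ← one_div]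
    linarith
  obtain ⟨X, hXW, hX, hdeg, hempty⟩ := exists_subset_degree_le_transTrianglesIn_eq_empty
    (by positivity) hedgesW (by linarith)
  refine ⟨X, hXW.trans hWs, by linarith, fun v hv => (hdeg v hv).trans_eq (by ring), hempty⟩

theorem not_adj_of_transTrianglesIn_eq_empty {u v w : V} (hs : D.transTrianglesIn s = ∅)
    (hu : u ∈ s) (hv : v ∈ s) (hw : w ∈ s) (huv : D.Adj u v) (huw : D.Adj u w) :
    ¬ D.Adj v w := fun hvw =>
  eq_empty_iff_forall_notMem.1 hs _ (mem_transTrianglesIn.2 ⟨hu, hv, hw, huv, huw, hvw⟩)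

theorem isIndepSet_outNeighbors {v : V} (hs : D.transTrianglesIn s = ∅) (hv : v ∈ s) :
    D.underlying.IsIndepSet ({w ∈ s | D.Adj v w} : Finset V) := by
  intro x hx y hy _ hxy
  obtain ⟨hxs, hvx⟩ := mem_filter.1 hx
  obtain ⟨hys, hvy⟩ := mem_filter.1 hy
  exact hxy.elim (not_adj_of_transTrianglesIn_eq_empty hs hv hxs hys hvx hvy)
    (not_adj_of_transTrianglesIn_eq_empty hs hv hys hxs hvy hvx)

theorem isIndepSet_inNeighbors {v : V} (hs : D.transTrianglesIn s = ∅) (hv : v ∈ s) :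
    D.underlying.IsIndepSet ({u ∈ s | D.Adj u v} : Finset V) := by
  intro x hx y hy _ hxy
  obtain ⟨hxs, hxv⟩ := mem_filter.1 hx
  obtain ⟨hys, hyv⟩ := mem_filter.1 hy
  exact hxy.elim (fun h => not_adj_of_transTrianglesIn_eq_empty hs hxs hys hv h hxv hyv)
    (fun h => not_adj_of_transTrianglesIn_eq_empty hs hys hxs hv h hyv hxv)

theorem exists_isIndepSet_of_transTrianglesIn_eq_empty {d : ℝ} (hd : 1 ≤ d)
    (hdeg : ∀ v ∈ s, (#{w ∈ s | D.underlying.Adj v w} : ℝ) ≤ d)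
    (hs : D.transTrianglesIn s = ∅) :
    ∃ W ⊆ s, D.underlying.IsIndepSet (W : Set V) ∧
      #s * Real.logb 2 d / (128 * d) ≤ (#W : ℝ) := by
  classical
  refine exists_isIndepSet_of_neighborhoods_subset_union hd hdeg fun v hv =>
    ⟨_, _, isIndepSet_outNeighbors hs hv, isIndepSet_inNeighbors hs hv, ?_⟩
  rw [← filter_or]
  rfl

theorem exists_isIndepSet_of_codegree_le {a b : ℝ} (hb : 1 ≤ b) (hba : b ≤ a)
    (hout : ∀ v ∈ s, (#{w ∈ s | D.Adj v w} : ℝ) ≤ a)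
    (hco : ∀ u ∈ s, ∀ v ∈ s, D.Adj u v → (#{w ∈ s | D.Adj u w ∧ D.Adj v w} : ℝ) ≤ b) :
    ∃ W ⊆ s, D.underlying.IsIndepSet (W : Set V) ∧
      #s * Real.logb 2 (a / b) / (2 ^ 15 * a) ≤ (#W : ℝ) := by
  have ha : 1 ≤ a := hb.trans hba
  have hab : 1 ≤ a / b := (one_le_div (by linarith)).2 hba
  have hsqrt : 1 ≤ √(a * b) := Real.one_le_sqrt.2 (one_le_mul_of_one_le_of_one_le ha hb)
  set p := 1 / (4 * √(a * b)) with hp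
  have hp0 : 0 < p := by positivity
  have hp1 : p ≤ 1 := by rw [hp, div_le_one (by positivity)]; linarith
  have hp2 : p ^ 2 = 1 / (16 * (a * b)) := by
    rw [hp, div_pow, mul_pow, Real.sq_sqrt (by positivity)]; norm_num
  obtain ⟨X, hXs, hXcard, hdeg, hempty⟩ := exists_sparse_subset (by linarith) (by linarith)
    hout hco hp0 hp1 (by rw [hp2]; field_simp; rfl)
  set d := 32 * (p * a) with hd
  have hd0 : 0 < d := by positivity
  have hd2 : d ^ 2 = 64 * (a / b) := by
    rw [hd, mul_pow, mul_pow, hp2]; field_simp; norm_num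
  have hd1 : 1 ≤ d := by nlinarith
  have hlog : Real.logb 2 (a / b) / 2 ≤ Real.logb 2 d := by
    have hmono : Real.logb 2 (a / b) ≤ Real.logb 2 (d ^ 2) :=
      Real.logb_le_logb_of_le one_lt_two (by linarith) (by linarith)
    rw [Real.logb_pow, Nat.cast_ofNat] at hmono
    linarith
  have hlog_nonneg : 0 ≤ Real.logb 2 (a / b) := Real.logb_nonneg one_lt_two hab
  obtain ⟨W, hWX, hWI, hWcard⟩ := exists_isIndepSet_of_transTrianglesIn_eq_empty hd1 hdeg hempty
  refine ⟨W, hWX.trans hXs, hWI, le_trans ?_ hWcard⟩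
  calc #s * Real.logb 2 (a / b) / (2 ^ 15 * a)
      = (p * #s / 4) * (Real.logb 2 (a / b) / 2) / (128 * d) := by rw [hd]; field_simp; ring
    _ ≤ #X * Real.logb 2 d / (128 * d) := by gcongr

end Sparsification

section FreeSubsets

variable {D} {m n : ℕ} {s t : Finset V}

theorem contains_independent_of_isIndepSet (ht : D.underlying.IsIndepSet (t : Set V)) :
    D.Contains (independent #t) :=
  ⟨⟨t.equivFin.symm.toEmbedding.trans (.subtype _), fun {i j} => by
    refine ⟨fun h => ?_, False.elim⟩
    exact ht (t.equivFin.symm i).2 (t.equivFin.symm j).2 (ne_of_adj h) (Or.inl h)⟩⟩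

theorem indepSetFree_underlying (h : ¬ D.Contains (independent m)) :
    D.underlying.IndepSetFree m := by
  rintro t ⟨ht, rfl⟩
  exact h (contains_independent_of_isIndepSet ht)

theorem contains_transTournament_of_pairwise {l : List V} (hl : l.Pairwise D.Adj) :
    D.Contains (transTournament l.length) :=
  ⟨RelEmbedding.ofMonotone (r := (· < ·)) l.get fun _ _ hij => List.pairwise_iff_get.1 hl _ _ hij⟩

variable (D) in
/-- The vertex set `s` contains no copy of `L_n`. A copy is encoded by the list of its vertices, in
the order in which the edges point; such a list has no repetitions because `D` has no loops. -/
def TransTournamentFreeOn (s : Finset V) (n : ℕ) : Prop :=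
  ∀ l : List V, l.Pairwise D.Adj → (∀ v ∈ l, v ∈ s) → l.length ≠ n

theorem transTournamentFreeOn_of_not_contains (h : ¬ D.Contains (transTournament n)) :
    D.TransTournamentFreeOn s n := by
  rintro l hl - rfl
  exact h (contains_transTournament_of_pairwise hl)

theorem TransTournamentFreeOn.outNeighbors [DecidableRel D.Adj] {v : V}
    (hs : D.TransTournamentFreeOn s (n + 1)) (hv : v ∈ s) :
    D.TransTournamentFreeOn {w ∈ s | D.Adj v w} n := by
  rintro l hl hls rfl
  refine hs (v :: l) (List.pairwise_cons.2 ⟨fun w hw => (mem_filter.1 (hls w hw)).2, hl⟩) ?_ rfl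
  exact List.forall_mem_cons.2 ⟨hv, fun w hw => (mem_filter.1 (hls w hw)).1⟩

theorem TransTournamentFreeOn.commonOutNeighbors [DecidableRel D.Adj] {u v : V}
    (hs : D.TransTournamentFreeOn s (n + 2)) (hu : u ∈ s) (hv : v ∈ s) (huv : D.Adj u v) :
    D.TransTournamentFreeOn {w ∈ s | D.Adj u w ∧ D.Adj v w} n := by
  rw [← filter_filter]
  exact (hs.outNeighbors hu).outNeighbors (mem_filter.2 ⟨hv, huv⟩)

theorem TransTournamentFreeOn.eq_empty (hs : D.TransTournamentFreeOn s 1) : s = ∅ :=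
  eq_empty_of_forall_notMem fun v hv =>
    hs [v] (List.pairwise_singleton _ _) (by simpa using hv) rfl

theorem TransTournamentFreeOn.isIndepSet (hs : D.TransTournamentFreeOn s 2) :
    D.underlying.IsIndepSet (s : Set V) := by
  intro u hu v hv _ huv
  obtain h | h := huv
  · exact hs [u, v] (List.pairwise_pair.2 h) (by simp_all) rfl
  · exact hs [v, u] (List.pairwise_pair.2 h) (by simp_all) rfl

/-- The bound `2 ^ 19 log₂ m (2 ^ 19 m / log₂ m) ^ k` on the order of oriented graphs without `I_m`
and `L_(k + 1)`, written as a geometric progression in `k` so that the induction step only involves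
its ratio. -/
noncomputable def freeBound (m k : ℕ) : ℝ :=
  2 ^ 19 * Real.logb 2 m * (2 ^ 19 * m / Real.logb 2 m) ^ k

theorem freeBound_succ (m k : ℕ) :
    freeBound m (k + 1) = 2 ^ 19 * m / Real.logb 2 m * freeBound m k := by
  simp only [freeBound, pow_succ]
  ring

theorem two_pow_le_freeBound (hm : 2 ≤ m) (k : ℕ) : 2 ^ 19 ≤ freeBound m k := by
  have hm' : (2 : ℝ) ≤ m := by exact_mod_cast hm
  have hratio : 2 ^ 19 ≤ 2 ^ 19 * m / Real.logb 2 m := le_mul_div_logb_two (by norm_num) hm'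
  have hpow : 1 ≤ (2 ^ 19 * m / Real.logb 2 m) ^ k := one_le_pow₀ (by linarith)
  rw [freeBound, mul_assoc]
  exact le_mul_of_one_le_right (by positivity)
    (one_le_mul_of_one_le_of_one_le (one_le_logb_two hm') hpow)

theorem card_add_one_le_of_indepSetFree [DecidableRel D.Adj] {b : ℝ} (hm : 2 ≤ m)
    (hb : 1 ≤ b) (hI : D.underlying.IndepSetFree m)
    (hout : ∀ v ∈ s, (#{w ∈ s | D.Adj v w} : ℝ) ≤ 2 ^ 19 * m / Real.logb 2 m * b)
    (hco : ∀ u ∈ s, ∀ v ∈ s, D.Adj u v → (#{w ∈ s | D.Adj u w ∧ D.Adj v w} : ℝ) ≤ b) :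
    (#s : ℝ) + 1 ≤ 2 ^ 19 * m / Real.logb 2 m * (2 ^ 19 * m / Real.logb 2 m * b) := by
  have hlog : 0 < Real.logb 2 m := Real.logb_pos one_lt_two (by exact_mod_cast hm)
  have hm' : (2 : ℝ) ≤ m := by exact_mod_cast hm
  have hlogq : Real.logb 2 m / 8 ≤ Real.logb 2 (2 ^ 19 * m / Real.logb 2 m) :=
    logb_two_div_eight_le_logb_mul_div_logb (by norm_num) hm'
  have hq : 2 ^ 19 ≤ 2 ^ 19 * m / Real.logb 2 m := le_mul_div_logb_two (by norm_num) hm'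
  have hqlog : 2 ^ 19 * m / Real.logb 2 m * Real.logb 2 m = 2 ^ 19 * m :=
    div_mul_cancel₀ _ hlog.ne'
  set q := 2 ^ 19 * m / Real.logb 2 m
  have hba : b ≤ q * b := le_mul_of_one_le_left (by positivity) (by linarith)
  obtain ⟨W, -, hWI, hW⟩ := exists_isIndepSet_of_codegree_le hb hba hout hco
  rw [mul_div_cancel_right₀ q (by positivity)] at hW
  by_contra! hlt
  have hcard : q * (q * b) / 2 ≤ #s := by nlinarith
  have hmW : (m : ℝ) ≤ #W := calc
    (m : ℝ) = q * Real.logb 2 m / 2 ^ 19 := by rw [hqlog]; field_simp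
    _ = (q * (q * b) / 2) * (Real.logb 2 m / 8) / (2 ^ 15 * (q * b)) := by field_simp; norm_num
    _ ≤ #s * Real.logb 2 q / (2 ^ 15 * (q * b)) := by gcongr
    _ ≤ #W := hW
  exact (card_lt_of_indepSetFree hI hWI).not_ge (by exact_mod_cast hmW)

theorem card_add_one_le_freeBound (hm : 2 ≤ m) (hI : D.underlying.IndepSetFree m) (k : ℕ)
    (hL : D.TransTournamentFreeOn s (k + 1)) : (#s : ℝ) + 1 ≤ freeBound m k := by
  classical
  induction k using Nat.twoStepInduction generalizing s with
  | zero =>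
    rw [hL.eq_empty, card_empty, Nat.cast_zero, zero_add]
    exact le_trans (by norm_num) (two_pow_le_freeBound hm 0)
  | one =>
    have hlog : 0 < Real.logb 2 m := Real.logb_pos one_lt_two (by exact_mod_cast hm)
    have hcard : (#s : ℝ) + 1 ≤ m := by exact_mod_cast card_lt_of_indepSetFree hI hL.isIndepSet
    have hbound : freeBound m 1 = 2 ^ 38 * m := by rw [freeBound]; field_simp
    linarith
  | more k ih₀ ih₁ =>
    rw [freeBound_succ, freeBound_succ]
    refine card_add_one_le_of_indepSetFree hm (le_trans (by norm_num) (two_pow_le_freeBound hm k))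
      hI (fun v hv => ?_) fun u hu v hv huv => ?_
    · rw [← freeBound_succ]
      exact (le_add_of_nonneg_right zero_le_one).trans (ih₁ (hL.outNeighbors hv))
    · exact (le_add_of_nonneg_right zero_le_one).trans (ih₀ (hL.commonOutNeighbors hu hv huv))

theorem freeBound_sub_one (hm : 2 ≤ m) (hn : 2 ≤ n) :
    freeBound m (n - 1) = 2 ^ (19 * n) * ((m : ℝ) ^ (n - 1) / Real.logb 2 m ^ (n - 2)) := by
  have hlog : 0 < Real.logb 2 m := Real.logb_pos one_lt_two (by exact_mod_cast hm)
  obtain ⟨j, rfl⟩ := Nat.exists_eq_add_of_le' hn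
  rw [freeBound, show j + 2 - 1 = j + 1 from rfl, Nat.add_sub_cancel, pow_mul]
  generalize (2 : ℝ) ^ 19 = c
  rw [div_pow, mul_pow]
  field_simp
  ring

theorem mem_orientedRamseySet_of_freeBound_lt {N : ℕ} (hm : 2 ≤ m) (hn : 1 ≤ n)
    (hN : freeBound m (n - 1) < N + 1) : N ∈ orientedRamseySet m n := by
  intro D
  by_contra! hfree
  have hcard := card_add_one_le_freeBound (s := univ) hm (indepSetFree_underlying hfree.1) (n - 1)
    (by rw [Nat.sub_add_cancel hn]; exact transTournamentFreeOn_of_not_contains hfree.2)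
  rw [card_univ, Fintype.card_fin] at hcard
  exact hcard.not_gt hN

end FreeSubsets

end OrientedGraph

theorem theorem3 (m n : ℕ) (hm : 2 ≤ m) (hn : 2 ≤ n) :
    (orientedRamseySet m n).Nonempty ∧
      (orientedRamsey m n : ℝ) ≤
        (2 : ℝ) ^ (19 * n) * ((m : ℝ) ^ (n - 1) / (Real.logb 2 (m : ℝ)) ^ (n - 2)) := by
  rw [← OrientedGraph.freeBound_sub_one hm hn]
  set B := OrientedGraph.freeBound m (n - 1)
  have hB : 0 ≤ B := le_trans (by norm_num) (OrientedGraph.two_pow_le_freeBound hm (n - 1))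
  have hmem : ⌊B⌋₊ ∈ orientedRamseySet m n :=
    OrientedGraph.mem_orientedRamseySet_of_freeBound_lt hm (by omega) (Nat.lt_floor_add_one B)
  refine ⟨⟨_, hmem⟩, ?_⟩
  calc (orientedRamsey m n : ℝ) ≤ ⌊B⌋₊ := by exact_mod_cast Nat.sInf_le hmem
    _ ≤ B := Nat.floor_le hB
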